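/- **Setting.** Let $K\ge 1$ and let $\mathcal D$ be a set of probability distributions on $\mathbb R$ with finite expectation. A bandit instance is $\nu=(\nu_a)_{a\in[K]}$ with all $\nu_a\in\mathcal D$; write $\mu_a=\mathbb E[\nu_a]$, $\mu^*=\max_a\mu_a$, $\Delta_a=\mu^*-\mu_a$ and $\mathcal A_*(\nu)=\{a:\mu_a=\mu^*\}$. At each round $t\ge 1$ the agent plays an arm $a_t\in[K]$ and decides whether to query, $q_t\in\{0,1\}$; the reward $R_t\sim\nu_{a_t}$ is drawn independently of the other rounds, and the agent observes $R_tq_t$. A strategy is a sequence of measurable maps from the history $(U_0,a_1,q_1,R_1q_1,U_1,\dots,a_t,q_t,R_tq_t,U_t)$ to $(a_{t+1},q_{t+1})$, where $U_0,U_1,\dots$ are i.i.d. uniform on $[0,1]$. Let $N_t(a)=\sum_{s\le t}\mathbf 1\{a_s=a\}$, $N^q_t(a)=\sum_{s\le t}\mathbf 1\{a_s=a,q_s=1\}$ and $\mathrm{Reg}(T)=\mathbb E_\nu\big[\sum_{t=1}^T\Delta_{a_t}\big]$. A strategy is better-than-uniform on $\mathcal D$ if $\sum_{a\in\mathcal A_*(\nu)}\mathbb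 E_\nu[N_T(a)]\ge\frac{|\mathcal A_*(\nu)|}{K}T$ for every instance $\nu$ with arms in $\mathcal D$ and every $T\ge 1$. Let $$\mathcal K_a=\mathcal K_{\inf}^+(\nu_a,\mu^*,\mathcal D)=\inf\{\mathrm{KL}(\nu_a,\nu'):\nu'\in\mathcal D,\ \mathbb E[\nu']>\mu^*\}\in[0,\infty],\qquad \inf\emptyset=\infty,$$ with the conventions $1/0=\infty$ and $1/\infty=0$. **Statement.** Fix a strategy that is better-than-uniform on $\mathcal D$ and an instance $\nu$ with all arms in $\mathcal D$. For each $a\in[K]$ let $B_a:\{1,2,\dots\}\to[0,\infty]$ be nondecreasing with $\mathbb E_\nu[N^q_t(a)]\le B_a(t)$ for all $t\ge 1$ (for example $B_a(t)=\mathbb E_\nu[N^q_t(a)]$). If no distribution in $\mathcal D$ has expectation larger than $\mu^*$, assume moreover that $B_a(1)>0$ for every $a\notin\mathcal A_*(\nu)$. Let $B_a^{-1}(x)=\sup\{t\ge 1:B_a(t)\le x\}\in\mathbb N\cup\{\infty\}$ if $x\ge B_a(1)$, and $B_a^{-1}(x)=0$ otherwise. Then for every integer $$T\ \ge\ \max_{a\notin\mathcal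 A_*(\nu)}B_a^{-1}\!\Big(\frac{1}{8K\mathcal K_a}\Big)$$ (the maximum over the empty set being $0$) it holds that $$\mathrm{Reg}(T)\ \ge\ \sum_{a\notin\mathcal A_*(\nu)}\frac{\Delta_a}{2K}\,B_a^{-1}\!\Big(\frac{1}{8K\mathcal K_a}\Big).$$ -/

import Mathlib

open MeasureTheory ProbabilityTheory InformationTheory
open scoped ENNReal

noncomputable section

namespace QueryBandit

/-- The expectation of a reward distribution. -/
def mean (ν : ProbabilityMeasure ℝ) : ℝ := ∫ x, x ∂(ν : Measure ℝ)

/-- `K_inf⁺(ν, μ, D) = inf {KL(ν, ν') : ν' ∈ D, E[ν'] > μ}`, with value `∞` if there is no such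
`ν'`. -/
def kInfPlus (ν : ProbabilityMeasure ℝ) (μ : ℝ) (D : Set (ProbabilityMeasure ℝ)) : ℝ≥0∞ :=
  ⨅ ν' ∈ {ν' | ν' ∈ D ∧ μ < mean ν'}, klDiv (ν : Measure ℝ) (ν' : Measure ℝ)

/-- A bandit instance with `K` arms: one reward distribution for each arm. -/
abbrev Instance (K : ℕ) : Type := Fin K → ProbabilityMeasure ℝ

/-- The optimal reward `μ* = max_a μ_a`. -/
def Instance.optMean {K : ℕ} (ν : Instance K) : ℝ := ⨆ a, mean (ν a)

/-- The set of optimal arms. -/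
def Instance.optArms {K : ℕ} (ν : Instance K) : Finset (Fin K) :=
  Finset.univ.filter fun a => mean (ν a) = ν.optMean

/-- The set of suboptimal arms. -/
def Instance.subArms {K : ℕ} (ν : Instance K) : Finset (Fin K) :=
  Finset.univ.filter fun a => a ∉ ν.optArms

/-- The suboptimality gap `Δ_a = μ* - μ_a`. -/
def Instance.gap {K : ℕ} (ν : Instance K) (a : Fin K) : ℝ := ν.optMean - mean (ν a)

/-- What a round `t` leaves in the history: the randomization variable `U_{t-1}` drawn before the
decision, the arm `a_t`, the query decision `q_t`, and the observation `R_t · q_t`. -/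
abbrev Record (K : ℕ) : Type := unitInterval × Fin K × Bool × ℝ

/-- The arm played in a round. -/
def Record.arm {K : ℕ} (r : Record K) : Fin K := r.2.1

/-- Whether the reward was queried in a round. -/
def Record.query {K : ℕ} (r : Record K) : Bool := r.2.2.1

/-- The records of the first `t` rounds. -/
abbrev History (K t : ℕ) : Type := Fin t → Record K

/-- A bandit strategy: a measurable map, for each `t`, from the records of the first `t` rounds
and the fresh internal randomization `U_t` to the next arm and the next query decision. -/
structure Strategy (K : ℕ) where
  /-- The decision for round `t + 1`. -/
  act : (t : ℕ) → History K t × unitInterval → Fin K × Bool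
  /-- The decisions are measurable. -/
  measurable_act : ∀ t, Measurable (act t)

/-- The reward of an arm, as a kernel from arms to rewards. -/
def rewardKernel {K : ℕ} (ν : Instance K) : Kernel (Fin K) ℝ :=
  Kernel.ofFunOfCountable fun a => (ν a : Measure ℝ)

/-- The law of the reward of round `t + 1`, given the past records and `U_t`: it is that of
the chosen arm. -/
def nextReward {K : ℕ} (π : Strategy K) (ν : Instance K) (t : ℕ) :
    Kernel (History K t × unitInterval) ℝ :=
  (rewardKernel ν).comap (fun p => (π.act t p).1) (π.measurable_act t).fst

/-- The history after round `t + 1`, from the past records, `U_t` and the reward of that round;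
the reward enters it only if it is queried. -/
def extend {K : ℕ} (π : Strategy K) (t : ℕ) (p : (History K t × unitInterval) × ℝ) :
    History K (t + 1) :=
  Fin.snoc (α := fun _ => Record K) p.1.1
    (p.1.2, (π.act t p.1).1, (π.act t p.1).2, if (π.act t p.1).2 = true then p.2 else 0)

/-- The law of the history of the first `t` rounds when strategy `π` interacts with instance `ν`.
In each round a fresh uniform variable is drawn independently of the past, the strategy chooses an
arm and whether to query, and the reward is drawn from the distribution of that arm. -/
def historyLaw {K : ℕ} (π : Strategy K) (ν : Instance K) : (t : ℕ) → Measure (History K t)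
  | 0 => Measure.dirac Fin.elim0
  | t + 1 => (((historyLaw π ν t).prod (volume : Measure unitInterval)) ⊗ₘ
      nextReward π ν t).map (extend π t)

lemma measurable_extend {K : ℕ} (π : Strategy K) (t : ℕ) : Measurable (extend π t) := by
  have hact : Measurable fun p : (History K t × unitInterval) × ℝ => π.act t p.1 :=
    (π.measurable_act t).comp measurable_fst
  refine measurable_pi_lambda _ fun i => ?_
  refine Fin.lastCases ?_ (fun j => ?_) i
  · simp only [extend, Fin.snoc_last]
    refine measurable_fst.snd.prodMk (hact.fst.prodMk (hact.snd.prodMk ?_))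
    exact Measurable.ite (hact.snd (measurableSet_singleton true)) measurable_snd measurable_const
  · simp only [extend, Fin.snoc_castSucc]
    exact (measurable_pi_apply j).comp measurable_fst.fst

instance isMarkovKernel_nextReward {K : ℕ} (π : Strategy K) (ν : Instance K) (t : ℕ) :
    IsMarkovKernel (nextReward π ν t) :=
  ⟨fun p => inferInstanceAs (IsProbabilityMeasure (ν (π.act t p).1 : Measure ℝ))⟩

instance isProbabilityMeasure_historyLaw {K : ℕ} (π : Strategy K) (ν : Instance K) (t : ℕ) :
    IsProbabilityMeasure (historyLaw π ν t) := by
  induction t with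
  | zero => exact Measure.dirac.isProbabilityMeasure
  | succ t ih => exact Measure.isProbabilityMeasure_map (measurable_extend π t).aemeasurable

/-- `N_t(a)`: the number of rounds in which arm `a` was played. -/
def plays {K t : ℕ} (a : Fin K) (h : History K t) : ℕ :=
  (Finset.univ.filter fun s : Fin t => (h s).arm = a).card

/-- `N^q_t(a)`: the number of rounds in which arm `a` was played and its reward queried. -/
def queries {K t : ℕ} (a : Fin K) (h : History K t) : ℕ :=
  (Finset.univ.filter fun s : Fin t => (h s).arm = a ∧ (h s).query = true).card

/-- `E_ν[N_t(a)]`. -/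
def expPlays {K : ℕ} (π : Strategy K) (ν : Instance K) (t : ℕ) (a : Fin K) : ℝ :=
  ∫ h, (plays a h : ℝ) ∂(historyLaw π ν t)

/-- `E_ν[N^q_t(a)]`, as an element of `[0, ∞]`. -/
def expQueries {K : ℕ} (π : Strategy K) (ν : Instance K) (t : ℕ) (a : Fin K) : ℝ≥0∞ :=
  ∫⁻ h, (queries a h : ℝ≥0∞) ∂(historyLaw π ν t)

/-- The regret `Reg(T) = E_ν[∑_{t ≤ T} Δ_{a_t}]`. -/
def regret {K : ℕ} (π : Strategy K) (ν : Instance K) (T : ℕ) : ℝ :=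
  ∫ h, ∑ s : Fin T, ν.gap (h s).arm ∂(historyLaw π ν T)

/-- A strategy is better than uniform on `D` if on each instance with arms in `D`, up to each time
`T ≥ 1`, the expected number of plays of optimal arms is at least `(|A_*(ν)| / K) T`. -/
def BetterThanUniform {K : ℕ} (π : Strategy K) (D : Set (ProbabilityMeasure ℝ)) : Prop :=
  ∀ ν : Instance K, (∀ a, ν a ∈ D) → ∀ T : ℕ, 1 ≤ T →
    (ν.optArms.card : ℝ) / K * T ≤ ∑ a ∈ ν.optArms, expPlays π ν T a

/-- The generalized inverse of a function `B` of the times `t ≥ 1`: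
`B⁻¹(x) = sup {t ≥ 1 : B(t) ≤ x}` (possibly `∞`) if `x ≥ B(1)`, and `B⁻¹(x) = 0` otherwise. -/
def genInv (B : ℕ → ℝ≥0∞) (x : ℝ≥0∞) : ℕ∞ :=
  if B 1 ≤ x then ⨆ t ∈ {t : ℕ | 1 ≤ t ∧ B t ≤ x}, (t : ℕ∞) else 0

/-- The number `1 / (8 K K_inf⁺(ν_a, μ*, D))` in `[0, ∞]`, with `1 / 0 = ∞` and `1 / ∞ = 0`. -/
def queryLevel {K : ℕ} (ν : Instance K) (D : Set (ProbabilityMeasure ℝ)) (a : Fin K) : ℝ≥0∞ :=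
  1 / (8 * (K : ℝ≥0∞) * kInfPlus (ν a) ν.optMean D)

end QueryBandit

end

/-! Only queried rewards carry information, while being better than uniform forces plays of any arm
that might be optimal. For a suboptimal arm `a`, replace its law by some `m ∈ D` of mean above `μ*`:
`a` becomes the unique optimal arm, so it is played at least `t / K` times in expectation. The two
history laws are within `E_ν[N^q_t(a)] · KL(ν_a, m)` of each other (`klDiv_historyLaw_update_le`),
and the change of measure `ofReal_half_integral_sub_le_klDiv`, applied to `N_t(a) / t`, carries
exploration back to `ν`. After the infimum over `m`, `E_ν[N_t(a)] ≥ t / (2K)` whenever the expected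
queries stay below `1 / (8 K K_a)` (`div_le_expPlays`). This is used at the last such `t` allowed by
`B_a`; monotonicity in time extends it to `T`, and summing against the gaps bounds the regret. -/

namespace QueryBandit

/-! ### Change of measure and divergence of kernels. -/

section KullbackLeibler

variable {α β : Type*} {mα : MeasurableSpace α} {mβ : MeasurableSpace β}

/-- The left side is the tangent line at `r = 1/2` of the convex function `klFun r = r log r + 1 -
r`. -/
lemma half_sub_mul_log_two_le_klFun {r : ℝ} (hr : 0 ≤ r) :
    1 / 2 - r * Real.log 2 ≤ klFun r := by
  rcases hr.eq_or_lt with rfl | hr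
  · norm_num [klFun]
  · have h := Real.one_sub_inv_le_log_of_pos (mul_pos two_pos hr)
    rw [Real.log_mul two_ne_zero hr.ne'] at h
    have h' := mul_le_mul_of_nonneg_left h hr.le
    have e : r * (1 - (2 * r)⁻¹) = r - 1 / 2 := by field_simp
    rw [e] at h'
    rw [klFun]
    linarith

lemma ofReal_integral_le_lintegral_ofReal {μ : Measure α} {g : α → ℝ} (hg : Integrable g μ) :
    ENNReal.ofReal (∫ x, g x ∂μ) ≤ ∫⁻ x, ENNReal.ofReal (g x) ∂μ := by
  calc ENNReal.ofReal (∫ x, g x ∂μ) ≤ ENNReal.ofReal (∫ x, max (g x) 0 ∂μ) :=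
        ENNReal.ofReal_le_ofReal (integral_mono hg hg.pos_part fun x => le_max_left _ _)
    _ = ∫⁻ x, ENNReal.ofReal (max (g x) 0) ∂μ :=
        ofReal_integral_eq_lintegral_ofReal hg.pos_part
          (Filter.Eventually.of_forall fun x => le_max_right _ _)
    _ = ∫⁻ x, ENNReal.ofReal (g x) ∂μ := by simp

/-- A one-sided change of measure inequality for functions with values in `[0, 1]`. -/
lemma ofReal_half_integral_sub_le_klDiv (P Q : Measure α) [IsFiniteMeasure P] [IsFiniteMeasure Q]
    {f : α → ℝ} (hf : Measurable f) (hf0 : ∀ x, 0 ≤ f x) (hf1 : ∀ x, f x ≤ 1) :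
    ENNReal.ofReal ((∫ x, f x ∂Q) / 2 - (∫ x, f x ∂P) * Real.log 2) ≤ klDiv P Q := by
  by_cases hac : P ≪ Q
  swap
  · simp [klDiv_of_not_ac hac]
  have hbdd : ∀ x, ‖f x‖ ≤ 1 := fun x => by
    rw [Real.norm_eq_abs, abs_of_nonneg (hf0 x)]; exact hf1 x
  have hfQ : Integrable f Q :=
    Integrable.of_bound hf.aestronglyMeasurable 1 (Filter.Eventually.of_forall hbdd)
  have hfP : Integrable f P :=
    Integrable.of_bound hf.aestronglyMeasurable 1 (Filter.Eventually.of_forall hbdd)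
  have hrf : Integrable (fun x => (P.rnDeriv Q x).toReal * f x) Q :=
    (integrable_toReal_rnDeriv_mul_iff hac).2 hfP
  have e1 : ∫ x, (P.rnDeriv Q x).toReal * f x ∂Q = ∫ x, f x ∂P := by
    simpa [smul_eq_mul] using integral_rnDeriv_smul (f := f) hac
  have e2 : (∫ x, f x ∂Q) / 2 - (∫ x, f x ∂P) * Real.log 2
      = ∫ x, (f x / 2 - (P.rnDeriv Q x).toReal * f x * Real.log 2) ∂Q := by
    rw [integral_sub (hfQ.div_const 2) (hrf.mul_const _), integral_div, integral_mul_const, e1]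
  rw [e2, klDiv_eq_lintegral_klFun_of_ac hac]
  refine (ofReal_integral_le_lintegral_ofReal ((hfQ.div_const 2).sub (hrf.mul_const _))).trans (lintegral_mono fun x => ?_)
  refine ENNReal.ofReal_le_ofReal ?_
  rw [Pi.sub_apply]
  have h0 : 0 ≤ (P.rnDeriv Q x).toReal := ENNReal.toReal_nonneg
  -- The tangent bound is weighted by `f ≥ 0`; then `f ≤ 1` and `klFun ≥ 0` allow the weight to be
  -- dropped.
  have h1 := mul_le_mul_of_nonneg_left (half_sub_mul_log_two_le_klFun h0) (hf0 x)
  have h2 := mul_le_mul_of_nonneg_right (hf1 x) (klFun_nonneg h0)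
  linarith

/-- If two kernels agree outside of a set on which both are constant, the divergence of the
composition-products is at most the measure of the set times the divergence of the constants. -/
lemma klDiv_compProd_le_mul_of_eq_off (μ : Measure α) [IsFiniteMeasure μ]
    (κ η : Kernel α β) [IsMarkovKernel κ] [IsMarkovKernel η]
    {S : Set α} (hS : MeasurableSet S) (m m' : Measure β) [IsFiniteMeasure m] [IsFiniteMeasure m']
    (hκ : ∀ x ∈ S, κ x = m) (hη : ∀ x ∈ S, η x = m') (heq : ∀ x ∉ S, κ x = η x) :
    klDiv (μ ⊗ₘ κ) (μ ⊗ₘ η) ≤ μ S * klDiv m m' := by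
  classical
  -- Treated apart because the bound is then `0`, by `0 * ∞ = 0`, even if `klDiv m m'` is infinite.
  by_cases hμS : μ S = 0
  · have h : μ ⊗ₘ κ = μ ⊗ₘ η := by
      refine Measure.compProd_congr ?_
      filter_upwards [measure_eq_zero_iff_ae_notMem.1 hμS] with x hx using heq x hx
    rw [h, klDiv_self]
    exact zero_le
  by_cases hac : m ≪ m'
  swap
  · rw [klDiv_of_not_ac hac, ENNReal.mul_top hμS]
    exact le_top
  -- The density of one composition-product with respect to the other; off `S` it is `1`, where
  -- `klFun` vanishes.
  set f : α × β → ℝ≥0∞ := fun p => if p.1 ∈ S then m.rnDeriv m' p.2 else 1 with hf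
  have hfm : Measurable f := Measurable.ite (measurable_fst hS)
    ((Measure.measurable_rnDeriv m m').comp measurable_snd) measurable_const
  have hdens : μ ⊗ₘ κ = (μ ⊗ₘ η).withDensity f := by
    ext s hs
    rw [withDensity_apply _ hs, ← lintegral_indicator hs,
      Measure.lintegral_compProd (hfm.indicator hs), Measure.compProd_apply hs]
    refine lintegral_congr fun x => ?_
    have hsx : MeasurableSet (Prod.mk x ⁻¹' s) := measurable_prodMk_left hs
    have e : ∀ y, s.indicator f (x, y) = (Prod.mk x ⁻¹' s).indicator (fun y => f (x, y)) y :=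
      fun y => rfl
    simp_rw [e]
    rw [lintegral_indicator hsx]
    by_cases hx : x ∈ S
    · simp only [hf, hx, if_true, hκ x hx, hη x hx]
      rw [Measure.setLIntegral_rnDeriv hac]
    · simp [hf, hx, heq x hx]
  have hac' : μ ⊗ₘ κ ≪ μ ⊗ₘ η := hdens ▸ withDensity_absolutelyContinuous _ _
  have hder : (μ ⊗ₘ κ).rnDeriv (μ ⊗ₘ η) =ᵐ[μ ⊗ₘ η] f := by
    rw [hdens]
    exact Measure.rnDeriv_withDensity _ hfm
  rw [klDiv_eq_lintegral_klFun_of_ac hac', klDiv_eq_lintegral_klFun_of_ac hac]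
  calc ∫⁻ p, ENNReal.ofReal (klFun ((μ ⊗ₘ κ).rnDeriv (μ ⊗ₘ η) p).toReal) ∂(μ ⊗ₘ η)
      = ∫⁻ p, ENNReal.ofReal (klFun (f p).toReal) ∂(μ ⊗ₘ η) := by
        refine lintegral_congr_ae ?_
        filter_upwards [hder] with p hp
        rw [hp]
    _ = ∫⁻ x, ∫⁻ y, ENNReal.ofReal (klFun (f (x, y)).toReal) ∂(η x) ∂μ :=
        Measure.lintegral_compProd (by fun_prop)
    _ = ∫⁻ x, S.indicator
          (fun _ => ∫⁻ y, ENNReal.ofReal (klFun (m.rnDeriv m' y).toReal) ∂m') x ∂μ := by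
        refine lintegral_congr fun x => ?_
        by_cases hx : x ∈ S
        · simp [hf, hx, hη x hx]
        · simp [hf, hx, klFun_one]
    _ = μ S * ∫⁻ y, ENNReal.ofReal (klFun (m.rnDeriv m' y).toReal) ∂m' := by
        rw [lintegral_indicator hS, setLIntegral_const, mul_comm]
    _ ≤ _ := le_rfl

end KullbackLeibler

/-! ### Counts along histories and the divergence of history laws. -/

variable {K : ℕ}

/-- The decisions that play and query the arm `a`. -/
def querySet (π : Strategy K) (t : ℕ) (a : Fin K) : Set (History K t × unitInterval) :=
  π.act t ⁻¹' {(a, true)}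

lemma measurableSet_querySet (π : Strategy K) (t : ℕ) (a : Fin K) :
    MeasurableSet (querySet π t a) :=
  π.measurable_act t (measurableSet_singleton _)

lemma measurable_plays {t : ℕ} (a : Fin K) : Measurable fun h : History K t => plays a h := by
  classical
  simp only [plays, Finset.card_filter]
  refine Finset.measurable_sum _ fun s _ => Measurable.ite ?_ measurable_const measurable_const
  exact ((measurable_pi_apply s).snd.fst : Measurable fun h : History K t => (h s).2.1)
    (measurableSet_singleton a)

lemma measurable_queries {t : ℕ} (a : Fin K) : Measurable fun h : History K t => queries a h := by
  classical
  simp only [queries, Finset.card_filter]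
  refine Finset.measurable_sum _ fun s _ => Measurable.ite ?_ measurable_const measurable_const
  exact (((measurable_pi_apply s).snd.fst : Measurable fun h : History K t => (h s).2.1)
    (measurableSet_singleton a)).inter
    (((measurable_pi_apply s).snd.snd.fst : Measurable fun h : History K t => (h s).2.2.1)
      (measurableSet_singleton true))

lemma plays_le {t : ℕ} (a : Fin K) (h : History K t) : plays a h ≤ t := by
  simpa [plays] using Finset.card_filter_le (Finset.univ : Finset (Fin t)) _

lemma queries_le {t : ℕ} (a : Fin K) (h : History K t) : queries a h ≤ t := by
  simpa [queries] using Finset.card_filter_le (Finset.univ : Finset (Fin t)) _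

lemma plays_init_le {t : ℕ} (a : Fin K) (h : History K (t + 1)) :
    plays a (fun s : Fin t => h s.castSucc) ≤ plays a h := by
  classical
  simp only [plays, Finset.card_filter, Fin.sum_univ_castSucc]
  exact Nat.le_add_right _ _

lemma queries_succ {t : ℕ} (a : Fin K) (h : History K (t + 1)) :
    queries a h = queries a (fun s : Fin t => h s.castSucc) +
      if (h (Fin.last t)).arm = a ∧ (h (Fin.last t)).query = true then 1 else 0 := by
  simp only [queries, Finset.card_filter, Fin.sum_univ_castSucc]

lemma measurable_init (t : ℕ) :
    Measurable fun (h : History K (t + 1)) (s : Fin t) => h s.castSucc :=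
  measurable_pi_lambda _ fun s => measurable_pi_apply s.castSucc

/-- Consistency of the history laws: it lets counts at different times be compared under a single
law. -/
lemma map_init_historyLaw (π : Strategy K) (ν : Instance K) (t : ℕ) :
    (historyLaw π ν (t + 1)).map (fun h (s : Fin t) => h s.castSucc) = historyLaw π ν t := by
  rw [historyLaw, Measure.map_map (measurable_init t) (measurable_extend π t)]
  have e : (fun (h : History K (t + 1)) (s : Fin t) => h s.castSucc) ∘ extend π t
      = Prod.fst ∘ Prod.fst := by
    funext p s
    simp [extend]
  rw [e, ← Measure.map_map measurable_fst measurable_fst]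
  change ((((historyLaw π ν t).prod volume) ⊗ₘ nextReward π ν t).fst).fst = _
  rw [Measure.fst_compProd, Measure.fst_prod]

lemma integrable_plays (π : Strategy K) (ν : Instance K) (t : ℕ) (a : Fin K) :
    Integrable (fun h => (plays a h : ℝ)) (historyLaw π ν t) := by
  refine Integrable.of_bound (C := t)
    (measurable_from_nat.comp (measurable_plays a)).aestronglyMeasurable
    (Filter.Eventually.of_forall fun h => ?_)
  simpa using plays_le a h

lemma expPlays_nonneg (π : Strategy K) (ν : Instance K) (t : ℕ) (a : Fin K) :
    0 ≤ expPlays π ν t a :=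
  integral_nonneg fun _ => Nat.cast_nonneg _

lemma expPlays_mono (π : Strategy K) (ν : Instance K) (a : Fin K) :
    Monotone fun t => expPlays π ν t a := by
  refine monotone_nat_of_le_succ fun t => ?_
  simp only [expPlays]
  have hm : Measurable fun h : History K t => (plays a h : ℝ) :=
    measurable_from_nat.comp (measurable_plays a)
  rw [← map_init_historyLaw π ν t,
    integral_map (measurable_init t).aemeasurable hm.aestronglyMeasurable]
  refine integral_mono_of_nonneg (Filter.Eventually.of_forall fun _ => Nat.cast_nonneg _)
    (integrable_plays π ν (t + 1) a) (Filter.Eventually.of_forall fun h => ?_)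
  exact Nat.cast_le.2 (plays_init_le a h)

lemma expQueries_succ (π : Strategy K) (ν : Instance K) (t : ℕ) (a : Fin K) :
    expQueries π ν (t + 1) a = expQueries π ν t a +
      ((historyLaw π ν t).prod (volume : Measure unitInterval)) (querySet π t a) := by
  classical
  have hm : ∀ t, Measurable fun h : History K t => (queries a h : ℝ≥0∞) := fun t =>
    measurable_from_nat.comp (measurable_queries a)
  have e1 : ∫⁻ h, (queries a (fun s : Fin t => h s.castSucc) : ℝ≥0∞) ∂(historyLaw π ν (t + 1))
      = expQueries π ν t a := by
    rw [expQueries, ← map_init_historyLaw π ν t, lintegral_map (hm t) (measurable_init t)]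
  have hE : MeasurableSet {h : History K (t + 1) |
      (h (Fin.last t)).arm = a ∧ (h (Fin.last t)).query = true} :=
    (((measurable_pi_apply (Fin.last t)).snd.fst :
      Measurable fun h : History K (t + 1) => (h (Fin.last t)).2.1)
        (measurableSet_singleton a)).inter
    (((measurable_pi_apply (Fin.last t)).snd.snd.fst :
      Measurable fun h : History K (t + 1) => (h (Fin.last t)).2.2.1)
        (measurableSet_singleton true))
  have e2 : historyLaw π ν (t + 1)
      {h | (h (Fin.last t)).arm = a ∧ (h (Fin.last t)).query = true}
      = ((historyLaw π ν t).prod (volume : Measure unitInterval)) (querySet π t a) := by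
    rw [historyLaw, Measure.map_apply (measurable_extend π t) hE]
    have e : extend π t ⁻¹' {h | (h (Fin.last t)).arm = a ∧ (h (Fin.last t)).query = true}
        = Prod.fst ⁻¹' querySet π t a := by
      ext p
      simp [extend, querySet, Record.arm, Record.query, Prod.ext_iff]
    rw [e, ← Measure.fst_apply (measurableSet_querySet π t a), Measure.fst_compProd]
  rw [← e1, ← e2, ← lintegral_indicator_one hE,
    ← lintegral_add_left (show Measurable fun h : History K (t + 1) =>
      (queries a (fun s : Fin t => h s.castSucc) : ℝ≥0∞) from (hm t).comp (measurable_init t)),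
    expQueries]
  refine lintegral_congr fun h => ?_
  rw [queries_succ, Set.indicator_apply]
  push_cast
  rfl

lemma expQueries_ne_top (π : Strategy K) (ν : Instance K) (t : ℕ) (a : Fin K) :
    expQueries π ν t a ≠ ∞ := by
  refine ne_top_of_le_ne_top (ENNReal.natCast_ne_top t) ?_
  calc expQueries π ν t a ≤ ∫⁻ _, (t : ℝ≥0∞) ∂(historyLaw π ν t) :=
        lintegral_mono fun h => Nat.cast_le.2 (queries_le a h)
    _ = t := by simp

/-- Replacing the reward law of an arm does not matter in the rounds that do not query it. -/
lemma map_extend_nextReward_update [DecidableEq (Fin K)] (π : Strategy K) (ν : Instance K)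
    (a : Fin K) (m : ProbabilityMeasure ℝ) (t : ℕ) (Q : Measure (History K t × unitInterval))
    [SFinite Q] [DecidablePred (· ∈ querySet π t a)] :
    (Q ⊗ₘ nextReward π (Function.update ν a m) t).map (extend π t) =
      (Q ⊗ₘ Kernel.piecewise (measurableSet_querySet π t a)
        (nextReward π (Function.update ν a m) t) (nextReward π ν t)).map (extend π t) := by
  ext s hs
  have hs' := measurable_extend π t hs
  rw [Measure.map_apply (measurable_extend π t) hs, Measure.map_apply (measurable_extend π t) hs,
    Measure.compProd_apply hs', Measure.compProd_apply hs']
  refine lintegral_congr fun x => ?_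
  rw [Kernel.piecewise_apply]
  split_ifs with hx
  · rfl
  change (Function.update ν a m (π.act t x).1 : Measure ℝ) _ = (ν (π.act t x).1 : Measure ℝ) _
  by_cases hq : (π.act t x).2 = true
  · have ha : (π.act t x).1 ≠ a := fun h => hx (Prod.ext h hq)
    rw [Function.update_of_ne ha]
  -- Without a query the new history does not depend on the reward, so each section is everything or
  -- empty and any two probability measures agree on it.
  · by_cases hmem : extend π t (x, 0) ∈ s
    · have e : Prod.mk x ⁻¹' (extend π t ⁻¹' s) = Set.univ := by
        ext r
        simpa [extend, hq] using hmem
      simp [e]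
    · have e : Prod.mk x ⁻¹' (extend π t ⁻¹' s) = ∅ := by
        ext r
        simpa [extend, hq] using hmem
      simp [e]

/-- The divergence decomposition: only queries of the modified arm are informative. -/
lemma klDiv_historyLaw_update_le [DecidableEq (Fin K)] (π : Strategy K) (ν : Instance K)
    (a : Fin K) (m : ProbabilityMeasure ℝ) (t : ℕ) :
    klDiv (historyLaw π ν t) (historyLaw π (Function.update ν a m) t) ≤
      expQueries π ν t a * klDiv (ν a : Measure ℝ) (m : Measure ℝ) := by
  classical
  induction t with
  | zero =>
    rw [historyLaw, historyLaw, klDiv_self]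
    exact zero_le
  | succ t ih =>
    rw [expQueries_succ, add_mul]
    change klDiv ((((historyLaw π ν t).prod (volume : Measure unitInterval)) ⊗ₘ
      nextReward π ν t).map (extend π t))
      ((((historyLaw π (Function.update ν a m) t).prod (volume : Measure unitInterval)) ⊗ₘ
      nextReward π (Function.update ν a m) t).map (extend π t)) ≤ _
    -- The reward kernels also differ when `a` is played unqueried. This must be removed before data
    -- processing discards `extend`.
    rw [map_extend_nextReward_update]
    refine (klDiv_map_le _ _ (measurable_extend π t)).trans ?_
    rw [klDiv_compProd_eq_add]
    refine add_le_add ?_ ?_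
    -- The fresh uniform variable has the same law under both instances and adds no divergence.
    · rw [← Measure.compProd_const, ← Measure.compProd_const, klDiv_compProd_left]
      exact ih
    · refine klDiv_compProd_le_mul_of_eq_off _ _ _ (measurableSet_querySet π t a) _ _
        (fun x hx => ?_) (fun x hx => ?_) (fun x hx => ?_)
      · change (ν (π.act t x).1 : Measure ℝ) = _
        rw [show π.act t x = (a, true) from hx]
      · rw [Kernel.piecewise_apply, if_pos hx]
        change (Function.update ν a m (π.act t x).1 : Measure ℝ) = _
        rw [show π.act t x = (a, true) from hx, Function.update_self]
      · rw [Kernel.piecewise_apply, if_neg hx]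

/-! ### Forced exploration of suboptimal arms. -/

lemma mean_le_optMean (ν : Instance K) (a : Fin K) : mean (ν a) ≤ ν.optMean :=
  le_ciSup (f := fun a => mean (ν a)) (Set.finite_range _).bddAbove a

lemma gap_nonneg (ν : Instance K) (a : Fin K) : 0 ≤ ν.gap a :=
  sub_nonneg.2 (mean_le_optMean ν a)

lemma optArms_update [DecidableEq (Fin K)] (ν : Instance K) (a : Fin K)
    (m : ProbabilityMeasure ℝ) (hm : ν.optMean < mean m) :
    Instance.optArms (Function.update ν a m) = {a} := by
  have : Nonempty (Fin K) := ⟨a⟩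
  have hlt : ∀ b, b ≠ a → mean (Function.update ν a m b) < mean m := fun b hb => by
    rw [Function.update_of_ne hb]
    exact (mean_le_optMean ν b).trans_lt hm
  have hopt : Instance.optMean (Function.update ν a m) = mean m := by
    refine le_antisymm (ciSup_le fun b => ?_) ?_
    · rcases eq_or_ne b a with rfl | hb
      · rw [Function.update_self]
      · exact (hlt b hb).le
    · simpa using mean_le_optMean (Function.update ν a m) a
  ext b
  simp only [Instance.optArms, Finset.mem_filter, Finset.mem_univ, true_and,
    Finset.mem_singleton, hopt]
  refine ⟨fun h => by_contra fun hb => (hlt b hb).ne h, ?_⟩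
  rintro rfl
  rw [Function.update_self]

/-- A better-than-uniform strategy explores each arm, by comparison with an instance in which
this arm is the unique optimal one. -/
lemma ofReal_sub_expPlays_le_mul_klDiv {D : Set (ProbabilityMeasure ℝ)}
    {π : Strategy K} (hπ : BetterThanUniform π D) {ν : Instance K} (hν : ∀ a, ν a ∈ D)
    (a : Fin K) {m : ProbabilityMeasure ℝ} (hmD : m ∈ D) (hm : ν.optMean < mean m)
    {t : ℕ} (ht : 1 ≤ t) :
    ENNReal.ofReal (1 / (2 * K) - expPlays π ν t a / t * Real.log 2) ≤
      expQueries π ν t a * klDiv (ν a : Measure ℝ) (m : Measure ℝ) := by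
  classical
  have ht0 : (0 : ℝ) < t := by exact_mod_cast ht
  have hD' : ∀ b, Function.update ν a m b ∈ D := fun b => by
    rcases eq_or_ne b a with rfl | hb
    · rwa [Function.update_self]
    · rw [Function.update_of_ne hb]
      exact hν b
  have hbtu := hπ _ hD' t ht
  rw [optArms_update ν a m hm, Finset.sum_singleton, Finset.card_singleton, Nat.cast_one] at hbtu
  refine le_trans ?_ (klDiv_historyLaw_update_le π ν a m t)
  refine le_trans (ENNReal.ofReal_le_ofReal ?_)
    (ofReal_half_integral_sub_le_klDiv _ _ (f := fun h => (plays a h : ℝ) / t)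
      ((measurable_from_nat.comp (measurable_plays a)).div_const _)
      (fun h => by positivity)
      (fun h => (div_le_one ht0).2 (Nat.cast_le.2 (plays_le a h))))
  rw [integral_div, integral_div]
  change _ ≤ expPlays π (Function.update ν a m) t a / t / 2 - expPlays π ν t a / t * Real.log 2
  have h1 : 1 / (K : ℝ) ≤ expPlays π (Function.update ν a m) t a / t := (le_div_iff₀ ht0).2 hbtu
  have h2 : 1 / (2 * (K : ℝ)) = 1 / K / 2 := by rw [div_div, mul_comm]
  linarith

lemma ofReal_sub_expPlays_le_mul_kInfPlus {D : Set (ProbabilityMeasure ℝ)}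
    {π : Strategy K} (hπ : BetterThanUniform π D) {ν : Instance K} (hν : ∀ a, ν a ∈ D)
    (a : Fin K) (hne : ∃ m ∈ D, ν.optMean < mean m) {t : ℕ} (ht : 1 ≤ t) :
    ENNReal.ofReal (1 / (2 * K) - expPlays π ν t a / t * Real.log 2) ≤
      expQueries π ν t a * kInfPlus (ν a) ν.optMean D := by
  have key := fun m hmD hm => ofReal_sub_expPlays_le_mul_klDiv hπ hν a (m := m) hmD hm ht
  -- With no queries, `0 * kInfPlus` is `0` even for an infinite infimum, so one actual competitor
  -- is needed; otherwise division by the positive finite query count reduces the claim to each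
  -- competitor.
  rcases eq_or_ne (expQueries π ν t a) 0 with h0 | h0
  · obtain ⟨m, hmD, hm⟩ := hne
    simpa [h0] using key m hmD hm
  · rw [mul_comm (expQueries π ν t a), ← ENNReal.div_le_iff h0 (expQueries_ne_top π ν t a)]
    refine le_iInf₂ fun m hm => ?_
    rw [ENNReal.div_le_iff h0 (expQueries_ne_top π ν t a), mul_comm (klDiv _ _)]
    exact key m hm.1 hm.2

/-- As long as the expected number of queries is below the level, an arm is played a fixed
fraction of the time. -/
lemma div_le_expPlays (hK : 1 ≤ K) {D : Set (ProbabilityMeasure ℝ)}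
    {π : Strategy K} (hπ : BetterThanUniform π D) {ν : Instance K} (hν : ∀ a, ν a ∈ D)
    (a : Fin K) (hne : ∃ m ∈ D, ν.optMean < mean m) {t : ℕ} (ht : 1 ≤ t)
    (hq : expQueries π ν t a ≤ queryLevel ν D a) :
    (t : ℝ) / (2 * K) ≤ expPlays π ν t a := by
  have hK0 : (0 : ℝ) < K := by exact_mod_cast hK
  have ht0 : (0 : ℝ) < t := by exact_mod_cast ht
  have h1 : expQueries π ν t a * (8 * (K : ℝ≥0∞) * kInfPlus (ν a) ν.optMean D) ≤ 1 :=
    ENNReal.mul_le_of_le_div hq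
  have h2 : ENNReal.ofReal (8 * K) *
      ENNReal.ofReal (1 / (2 * K) - expPlays π ν t a / t * Real.log 2) ≤ ENNReal.ofReal 1 := by
    rw [ENNReal.ofReal_one]
    refine le_trans ?_ h1
    rw [ENNReal.ofReal_mul (by norm_num), ENNReal.ofReal_natCast, ENNReal.ofReal_ofNat,
      mul_left_comm]
    exact mul_le_mul_right (ofReal_sub_expPlays_le_mul_kInfPlus hπ hν a hne ht) _
  rw [← ENNReal.ofReal_mul (by positivity), ENNReal.ofReal_le_ofReal_iff zero_le_one] at h2
  have h3 : 8 * (K : ℝ) * (1 / (2 * K) - expPlays π ν t a / t * Real.log 2)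
      = 4 - 8 * (K * (expPlays π ν t a / t)) * Real.log 2 := by
    field_simp
    ring
  rw [h3] at h2
  have hlog := Real.log_two_lt_d9
  have hp : 0 ≤ expPlays π ν t a / t := div_nonneg (expPlays_nonneg π ν t a) ht0.le
  -- Here `h2` reads `4 - 8 x log 2 ≤ 1`, so `x ≥ 3 / (8 log 2) > 1/2`.
  have h4 : 1 / 2 ≤ K * (expPlays π ν t a / t) := by nlinarith [mul_nonneg hK0.le hp]
  rw [div_le_iff₀ (by positivity)]
  have h5 : t * (K * (expPlays π ν t a / t)) = K * expPlays π ν t a := by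
    field_simp
  nlinarith [mul_le_mul_of_nonneg_left h4 ht0.le]

/-- A finite supremum of a nonempty set of integers is attained; the bound by `T` provides
finiteness. -/
lemma exists_genInv_eq {B : ℕ → ℝ≥0∞} {x : ℝ≥0∞} {T : ℕ} (hT : genInv B x ≤ T)
    (h0 : genInv B x ≠ 0) : ∃ t : ℕ, 1 ≤ t ∧ B t ≤ x ∧ genInv B x = t := by
  unfold genInv at hT h0 ⊢
  split_ifs at hT h0 ⊢ with h1
  · have : Nonempty ((fun t : ℕ => (t : ℕ∞)) '' {t : ℕ | 1 ≤ t ∧ B t ≤ x}) :=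
      ⟨⟨_, 1, ⟨le_rfl, h1⟩, rfl⟩⟩
    rw [← sSup_image] at hT ⊢
    obtain ⟨t, ht, e⟩ := ENat.sSup_mem_of_nonempty_of_lt_top
      (hT.trans_lt (ENat.natCast_lt_top T))
    exact ⟨t, ht.1, ht.2, e.symm⟩
  · exact absurd rfl h0

lemma regret_eq_sum (π : Strategy K) (ν : Instance K) (T : ℕ) :
    regret π ν T = ∑ a, ν.gap a * expPlays π ν T a := by
  classical
  simp only [regret, expPlays, ← integral_const_mul]
  rw [← integral_finsetSum _ fun a _ => (integrable_plays π ν T a).const_mul _]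
  refine integral_congr_ae (Filter.Eventually.of_forall fun h => ?_)
  change ∑ s, ν.gap (h s).arm = ∑ a, ν.gap a * (plays a h : ℝ)
  simp only [plays, Finset.card_filter, Nat.cast_sum, Finset.mul_sum]
  rw [Finset.sum_comm]
  simp

end QueryBandit

theorem corollary1 {K : ℕ} (hK : 1 ≤ K) (D : Set (ProbabilityMeasure ℝ))
    (hD : ∀ ν' ∈ D, Integrable (fun x : ℝ => x) (ν' : Measure ℝ))
    (π : QueryBandit.Strategy K) (hπ : QueryBandit.BetterThanUniform π D)
    (ν : QueryBandit.Instance K) (hν : ∀ a, ν a ∈ D)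
    (B : Fin K → ℕ → ℝ≥0∞)
    (hBmono : ∀ a, ∀ s t : ℕ, 1 ≤ s → s ≤ t → B a s ≤ B a t)
    (hB : ∀ a, ∀ t : ℕ, 1 ≤ t → QueryBandit.expQueries π ν t a ≤ B a t)
    (hBpos : (∀ ν' ∈ D, QueryBandit.mean ν' ≤ ν.optMean) → ∀ a ∈ ν.subArms, 0 < B a 1)
    (T : ℕ)
    (hT : (ν.subArms.sup fun a => QueryBandit.genInv (B a) (QueryBandit.queryLevel ν D a))
      ≤ (T : ℕ∞)) :
    ∑ a ∈ ν.subArms, ν.gap a / (2 * (K : ℝ)) *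
        ((QueryBandit.genInv (B a) (QueryBandit.queryLevel ν D a)).toNat : ℝ)
      ≤ QueryBandit.regret π ν T := by
  rw [QueryBandit.regret_eq_sum]
  refine le_trans (Finset.sum_le_sum fun a ha => ?_)
    (Finset.sum_le_sum_of_subset_of_nonneg (Finset.subset_univ ν.subArms)
      fun a _ _ => mul_nonneg (QueryBandit.gap_nonneg ν a) (QueryBandit.expPlays_nonneg π ν T a))
  rw [div_mul_eq_mul_div, mul_div_assoc]
  refine mul_le_mul_of_nonneg_left ?_ (QueryBandit.gap_nonneg ν a)
  by_cases h0 : QueryBandit.genInv (B a) (QueryBandit.queryLevel ν D a) = 0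
  · simpa [h0] using QueryBandit.expPlays_nonneg π ν T a
  have haT : QueryBandit.genInv (B a) (QueryBandit.queryLevel ν D a) ≤ T := (Finset.le_sup (f := fun a =>
    QueryBandit.genInv (B a) (QueryBandit.queryLevel ν D a)) ha).trans hT
  obtain ⟨t, ht, hBt, e⟩ := QueryBandit.exists_genInv_eq haT h0
  -- Without a competitor the level is `1 / ∞ = 0`, and positivity of `B a 1` contradicts `B a t ≤
  -- 0`.
  have hne : ∃ m ∈ D, ν.optMean < QueryBandit.mean m := by
    by_contra! hcon
    have htop : QueryBandit.kInfPlus (ν a) ν.optMean D = ∞ :=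
      iInf₂_eq_top.2 fun m hm => absurd hm.2 (hcon m hm.1).not_gt
    have hlev : QueryBandit.queryLevel ν D a = 0 := by
      have hK' : (8 * (K : ℝ≥0∞)) ≠ 0 :=
        mul_ne_zero (by norm_num) (Nat.cast_ne_zero.2 (by omega))
      rw [QueryBandit.queryLevel, htop, ENNReal.mul_top hK', ENNReal.div_top]
    have hB1 : B a 1 ≤ 0 := (hBmono a 1 t le_rfl ht).trans (hlev ▸ hBt)
    exact (hBpos hcon a ha).not_ge hB1
  rw [e] at haT ⊢
  rw [ENat.toNat_natCast]
  exact (QueryBandit.div_le_expPlays hK hπ hν a hne ht ((hB a t ht).trans hBt)).trans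
    (QueryBandit.expPlays_mono π ν a (Nat.cast_le.1 haT))
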